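/- Let $H$ be a finite-dimensional real vector space with a non-degenerate symmetric bilinear form $q$ of signature $(3,p)$, extended $\mathbb{C}$-bilinearly to $H_{\mathbb{C}}$, and let $$D=\{[\sigma]\in\mathbb{P}(H_{\mathbb{C}}) \mid q(\sigma,\sigma)=0,\ q(\sigma,\bar\sigma)>0\}$$ be the associated period domain of K3-type, an open subset of a smooth quadric, so that $\dim D=\dim H-2=p+1$. Let $\omega_D=i\Theta(\mathcal{L},h)$ be the Griffiths–Schmid metric, i.e. the curvature form of the tautological line bundle $\mathcal{L}=\mathcal{O}(-1)|_D$ with the hermitian metric $h(\sigma,\sigma)=q(\sigma,\bar\sigma)$. Let $\Delta\subset\mathbb{C}$ be the open unit disk with its Poincaré distance $\delta$. A non-constant holomorphic map $f:\Delta\to D$ is called a *positive disk* if its canonical lift $f':\Delta\to\mathbb{P}(T_D)$ to the bundle of tangent lines takes values in the set of lines on which $\omega_D$ is positive. The *positive Kobayashi pseudo-distance* $d_p$ on $D$ is the largest pseudo-distance $d$ on $D$ (with values in $[0,\infty]$) such that $d(f(a),f(b))\le\delta(a,b)$ for every positive disk $f$ and all $a,b\in\Delta$. Assume that $\dim D\ge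 2$. Then $d_p(x,y)=0$ for all $x,y\in D$. Moreover, $d_p$ can be computed using chains of positive disks that extend to rational curves inside $D$: for all $x,y\in D$, $$d_p(x,y)=\inf\ \sum_{i=1}^k\delta(a_i,b_i),$$ where the infimum is over all $k\ge 0$, points $x=p_0,\dots,p_k=y$ of $D$, points $a_1,b_1,\dots,a_k,b_k\in\Delta$ and positive disks $f_1,\dots,f_k:\Delta\to D$ with $f_i(a_i)=p_{i-1}$ and $f_i(b_i)=p_i$ such that each $f_i$ is the restriction to $\Delta\subset\mathbb{C}\subset\mathbb{P}^1$ of a holomorphic map $\mathbb{P}^1\to D$. -/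

import Mathlib

open scoped TensorProduct LinearAlgebra.Projectivization ENNReal Topology

noncomputable section

namespace K3Period

/-! ### Linear algebra on the complexification `H_ℂ = ℂ ⊗ H` of a real vector space `H` -/

/-- Complex conjugation on `H_ℂ`, with fixed space `H`. -/
def conj (H : Type*) [AddCommGroup H] [Module ℝ H] : (ℂ ⊗[ℝ] H) →ₗ[ℝ] (ℂ ⊗[ℝ] H) :=
  LinearMap.rTensor H Complex.conjAe.toLinearMap

/-- The `ℂ`-bilinear extension of `q` to `H_ℂ`. -/
def qC {H : Type*} [AddCommGroup H] [Module ℝ H] (q : LinearMap.BilinForm ℝ H) :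
    LinearMap.BilinForm ℂ (ℂ ⊗[ℝ] H) :=
  LinearMap.BilinForm.baseChange ℂ q

/-- The real number `q(v, v̄)`.  On the lines belonging to the period domain, i.e. on the fibres of
the Hodge bundle `F² = H^{2,0}`, this is the Hodge metric `h(v, v)`. -/
def hermSq {H : Type*} [AddCommGroup H] [Module ℝ H] (q : LinearMap.BilinForm ℝ H)
    (v : ℂ ⊗[ℝ] H) : ℝ :=
  (qC q v (conj H v)).re

/-! ### The period domain and its tangent spaces -/

/-- The period domain `D = {[v] ∈ ℙ(H_ℂ) | q(v, v) = 0, q(v, v̄) > 0}`. -/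
def periodDomain {H : Type*} [AddCommGroup H] [Module ℝ H] (q : LinearMap.BilinForm ℝ H) :
    Set (ℙ ℂ (ℂ ⊗[ℝ] H)) :=
  {l | ∃ (v : ℂ ⊗[ℝ] H) (hv : v ≠ 0),
    l = Projectivization.mk ℂ v hv ∧ qC q v v = 0 ∧ 0 < hermSq q v}

/-- The step `F¹ = (F²)^⊥` of the Hodge filtration attached to the line `F² = l`. -/
def hodgeF1 {H : Type*} [AddCommGroup H] [Module ℝ H] (q : LinearMap.BilinForm ℝ H)
    (l : ℙ ℂ (ℂ ⊗[ℝ] H)) : Submodule ℂ (ℂ ⊗[ℝ] H) :=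
  (qC q).orthogonal l.submodule

/-- The tangent space `T_{D,l} = Hom(F², F¹ / F²)` of the period domain at `l`. -/
abbrev TangentSpace {H : Type*} [AddCommGroup H] [Module ℝ H] (q : LinearMap.BilinForm ℝ H)
    (l : ℙ ℂ (ℂ ⊗[ℝ] H)) : Type _ :=
  l.submodule →ₗ[ℂ] (hodgeF1 q l ⧸ l.submodule.comap (hodgeF1 q l).subtype)

/-- The dimension of the period domain, an open subset of a smooth quadric hypersurface
of `ℙ(H_ℂ)`; it is the dimension of all its tangent spaces, see `finrank_tangentSpace`. -/
def dim {H : Type*} [AddCommGroup H] [Module ℝ H] (_q : LinearMap.BilinForm ℝ H) : ℕ :=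
  Module.finrank ℝ H - 2

theorem finrank_tangentSpace {H : Type*} [AddCommGroup H] [Module ℝ H] [FiniteDimensional ℝ H]
    (q : LinearMap.BilinForm ℝ H) (l : ℙ ℂ (ℂ ⊗[ℝ] H)) (hl : l ∈ periodDomain q) :
    Module.finrank ℂ (TangentSpace q l) = dim q := by
  obtain ⟨v, hv, rfl, h0, hpos⟩ := hl
  have hF1 : hodgeF1 q (Projectivization.mk ℂ v hv) = LinearMap.ker (qC q v) := by
    ext x
    simp only [hodgeF1, Projectivization.submodule_mk, LinearMap.BilinForm.mem_orthogonal_iff,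
      LinearMap.mem_ker]
    constructor
    · intro h
      exact h v (Submodule.mem_span_singleton_self v)
    · intro h n hn
      obtain ⟨a, rfl⟩ := Submodule.mem_span_singleton.1 hn
      simp [h]
  have hle : (Projectivization.mk ℂ v hv).submodule ≤ hodgeF1 q (Projectivization.mk ℂ v hv) := by
    rw [hF1, Projectivization.submodule_mk, Submodule.span_singleton_le_iff_mem]
    exact h0
  have hne : qC q v ≠ 0 := by
    intro h
    simp [hermSq, h] at hpos
  have hk : Module.finrank ℂ (hodgeF1 q (Projectivization.mk ℂ v hv)) + 1
      = Module.finrank ℝ H := by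
    rw [hF1, Module.Dual.finrank_ker_add_one_of_ne_zero hne, Module.finrank_baseChange]
  have hc : Module.finrank ℂ ((Projectivization.mk ℂ v hv).submodule.comap
      (hodgeF1 q (Projectivization.mk ℂ v hv)).subtype) = 1 := by
    rw [(Submodule.comapSubtypeEquivOfLe hle).finrank_eq, Projectivization.finrank_submodule]
  rw [Module.finrank_linearMap, Projectivization.finrank_submodule, one_mul,
    Submodule.finrank_quotient, hc, dim]
  omega

/-! ### The Griffiths-Schmid metric -/

/-- The Griffiths-Schmid metric `ω_D = iΘ(F², h)`, evaluated on the tangent vector `F² → F¹ / F²`,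
`u ↦ w mod u` of `D` at `[u]`, for `u ≠ 0` and `w ∈ F¹`.

If `s` is a local holomorphic section of the tautological line bundle without zeros, then
`iΘ = -i ∂∂̄ log h(s, s)`.  Along the curve `z ↦ [u + z w]`, whose velocity at `0` is the tangent
vector `u ↦ w mod u` and along which `s = u + z w` is such a section, this is
`i (-¼ Δ log q(s, s̄)) dz ∧ dz̄`, where `Δ = 4 ∂_z ∂_z̄` is the Laplacian of the plane.  (The curve
lies in the open set of all lines of `ℙ(H_ℂ)` on which `q(v, v̄) > 0`, to which the hermitian line
bundle `(F², h)` extends as the tautological bundle; its curvature there restricts to `ω_D`.) -/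
def griffithsSchmid {H : Type*} [AddCommGroup H] [Module ℝ H] (q : LinearMap.BilinForm ℝ H)
    (u w : ℂ ⊗[ℝ] H) : ℝ :=
  -(1 / 4) * Laplacian.laplacian (fun z : ℂ => Real.log (hermSq q (u + z • w))) 0

/-! ### Holomorphic maps -/

/-- Holomorphy near `z₀` of a function with values in a finite-dimensional complex vector space:
all its coordinates are holomorphic. -/
def HolomorphicAt {V : Type*} [AddCommGroup V] [Module ℂ V] (F : ℂ → V) (z₀ : ℂ) : Prop :=
  ∀ φ : Module.Dual ℂ V, AnalyticAt ℂ (fun z => φ (F z)) z₀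

/-- `F` is a local holomorphic lift near `z₀`, without zeros, of the map `f` into `ℙ(V)`. -/
def IsLocalLift {V : Type*} [AddCommGroup V] [Module ℂ V] (f : ℂ → ℙ ℂ V) (z₀ : ℂ) (F : ℂ → V) :
    Prop :=
  HolomorphicAt F z₀ ∧ ∀ᶠ z in 𝓝 z₀, ∃ hz : F z ≠ 0, f z = Projectivization.mk ℂ (F z) hz

/-- Holomorphy on an open set `U ⊆ ℂ` of a map into `ℙ(V)`.  A map with values in a locally closed
complex submanifold of `ℙ(V)`, such as the period domain, is holomorphic as a map into the
submanifold if and only if it is holomorphic as a map into `ℙ(V)`. -/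
def HolomorphicOn {V : Type*} [AddCommGroup V] [Module ℂ V] (f : ℂ → ℙ ℂ V) (U : Set ℂ) : Prop :=
  ∀ z₀ ∈ U, ∃ F : ℂ → V, IsLocalLift f z₀ F

/-- The line spanned by the tangent vector `u ↦ w mod u` at `[u]` is the value at `z₀` of the
canonical lift `f'` to the projectivized tangent bundle of a holomorphic map `f`.

In terms of a local lift `F` of `f`, the derivative of `f` at `z` is the tangent vector
`F(z) ↦ F'(z) mod F(z)`.  It is written here as `(z - z₀)^k` times the tangent vector
`F(z) ↦ G(z) mod F(z)`, with `G` holomorphic and `G(z₀) ∉ ℂ F(z₀)`, so that `f'` is spanned by the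
latter near `z₀`, also when `z₀` is a critical point of `f`.  The congruence
`F' ≡ (z - z₀)^k G mod F` is tested on the linear forms that vanish on `F(z)`. -/
def IsTangentLift {V : Type*} [AddCommGroup V] [Module ℂ V] (f : ℂ → ℙ ℂ V) (z₀ : ℂ) (u w : V) :
    Prop :=
  ∃ (F G : ℂ → V) (k : ℕ), IsLocalLift f z₀ F ∧ HolomorphicAt G z₀ ∧
    (∀ᶠ z in 𝓝 z₀, ∀ φ : Module.Dual ℂ V, φ (F z) = 0 →
      deriv (fun ζ => φ (F ζ)) z = (z - z₀) ^ k * φ (G z)) ∧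
    F z₀ = u ∧ G z₀ = w ∧ w ∉ Submodule.span ℂ {u}

/-! ### Positive disks, rational curves and chains -/

/-- The open unit disk. -/
abbrev disk : Set ℂ := Metric.ball 0 1

/-- `f`, restricted to the unit disk, is a positive holomorphic disk in `D`: it is holomorphic,
non-constant, and its lift to the projectivized tangent bundle takes values in the lines on which
`ω_D` is positive.  (The values of `f` outside the disk are irrelevant.) -/
structure IsPositiveDisk {H : Type*} [AddCommGroup H] [Module ℝ H] (q : LinearMap.BilinForm ℝ H)
    (f : ℂ → periodDomain q) : Prop where
  holomorphic : HolomorphicOn (fun z => (f z : ℙ ℂ (ℂ ⊗[ℝ] H))) disk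
  nonconstant : ∃ a ∈ disk, ∃ b ∈ disk, f a ≠ f b
  positive : ∀ z₀ ∈ disk, ∃ u w : ℂ ⊗[ℝ] H,
    IsTangentLift (fun z => (f z : ℙ ℂ (ℂ ⊗[ℝ] H))) z₀ u w ∧ 0 < griffithsSchmid q u w

/-- The inclusion `ℂ → ℙ¹`, `z ↦ [z : 1]`. -/
def chartZero (z : ℂ) : ℙ ℂ (Fin 2 → ℂ) :=
  Projectivization.mk ℂ ![z, 1] (fun h => one_ne_zero (congrFun h 1))

/-- The chart of `ℙ¹` around infinity, `z ↦ [1 : z]`. -/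
def chartInfty (z : ℂ) : ℙ ℂ (Fin 2 → ℂ) :=
  Projectivization.mk ℂ ![1, z] (fun h => one_ne_zero (congrFun h 0))

/-- The disk `f` extends to a rational curve in `D`: it is the restriction to the unit disk in
`ℂ ⊆ ℙ¹` of a holomorphic map `g : ℙ¹ → D`. -/
def ExtendsToRationalCurve {H : Type*} [AddCommGroup H] [Module ℝ H]
    (q : LinearMap.BilinForm ℝ H) (f : ℂ → periodDomain q) : Prop :=
  ∃ g : ℙ ℂ (Fin 2 → ℂ) → periodDomain q,
    HolomorphicOn (fun z => (g (chartZero z) : ℙ ℂ (ℂ ⊗[ℝ] H))) Set.univ ∧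
    HolomorphicOn (fun z => (g (chartInfty z) : ℙ ℂ (ℂ ⊗[ℝ] H))) Set.univ ∧
    ∀ z ∈ disk, f z = g (chartZero z)

/-- The Poincaré distance of the unit disk (of curvature `-1`), for `a` and `b` in the disk. -/
def poincareDist (a b : ℂ) : ℝ≥0∞ :=
  ENNReal.ofReal (2 * Real.artanh ‖(a - b) / (1 - (starRingEnd ℂ) a * b)‖)

/-- A chain from `x` to `y` of disks belonging to the family `𝓕`. -/
structure DiskChain {X : Type*} (𝓕 : Set (ℂ → X)) (x y : X) where
  k : ℕ
  pt : Fin (k + 1) → X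
  pt_zero : pt 0 = x
  pt_last : pt (Fin.last k) = y
  a : Fin k → ℂ
  b : Fin k → ℂ
  a_mem : ∀ i, a i ∈ disk
  b_mem : ∀ i, b i ∈ disk
  f : Fin k → ℂ → X
  f_mem : ∀ i, f i ∈ 𝓕
  f_a : ∀ i, f i (a i) = pt i.castSucc
  f_b : ∀ i, f i (b i) = pt i.succ

/-- The length of a chain of disks. -/
def DiskChain.length {X : Type*} {𝓕 : Set (ℂ → X)} {x y : X} (c : DiskChain 𝓕 x y) : ℝ≥0∞ :=
  ∑ i, poincareDist (c.a i) (c.b i)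

/-! ### The positive Kobayashi pseudo-distance -/

/-- Pseudo-distances; the value `∞` is allowed. -/
structure IsPseudoDist {X : Type*} (d : X → X → ℝ≥0∞) : Prop where
  self : ∀ x, d x x = 0
  symm : ∀ x y, d x y = d y x
  triangle : ∀ x y z, d x z ≤ d x y + d y z

/-- The pseudo-distances `d` on `D` with `f^* d ≤ δ` for every positive disk `f`, where `δ` is the
Poincaré distance. -/
def admissible {H : Type*} [AddCommGroup H] [Module ℝ H] (q : LinearMap.BilinForm ℝ H) :
    Set (periodDomain q → periodDomain q → ℝ≥0∞) :=
  {d | IsPseudoDist d ∧ ∀ f, IsPositiveDisk q f →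
    ∀ a ∈ disk, ∀ b ∈ disk, d (f a) (f b) ≤ poincareDist a b}

/-- The positive Kobayashi pseudo-distance of `D`: the largest pseudo-distance `d` with
`f^* d ≤ δ` for every positive disk `f`. -/
def positiveKobayashi {H : Type*} [AddCommGroup H] [Module ℝ H] (q : LinearMap.BilinForm ℝ H) :
    periodDomain q → periodDomain q → ℝ≥0∞ :=
  sSup (admissible q)

theorem isGreatest_positiveKobayashi {H : Type*} [AddCommGroup H] [Module ℝ H]
    (q : LinearMap.BilinForm ℝ H) : IsGreatest (admissible q) (positiveKobayashi q) := by
  have happ : ∀ x y, positiveKobayashi q x y = ⨆ d : admissible q, d.1 x y := by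
    intro x y
    simp [positiveKobayashi, sSup_apply]
  refine ⟨⟨⟨fun x => ?_, fun x y => ?_, fun x y z => ?_⟩, fun f hf a ha b hb => ?_⟩,
    fun d hd => le_sSup hd⟩
  · rw [happ]
    simp only [ENNReal.iSup_eq_zero]
    exact fun d => d.2.1.self x
  · rw [happ, happ]
    exact iSup_congr fun d => d.2.1.symm x y
  · rw [happ x z]
    refine iSup_le fun d => (d.2.1.triangle x y z).trans ?_
    rw [happ, happ]
    exact add_le_add (le_iSup (fun d : admissible q => d.1 x y) d)
      (le_iSup (fun d : admissible q => d.1 y z) d)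
  · rw [happ]
    exact iSup_le fun d => d.2.2 f hf a ha b hb

end K3Period

end

open scoped TensorProduct LinearAlgebra.Projectivization ENNReal Topology

noncomputable section

namespace K3Period

variable {H : Type*} [AddCommGroup H] [Module ℝ H] {q : LinearMap.BilinForm ℝ H}

/-! ### The Laplacian of the logarithm of a quadratic polynomial -/

/-! Moving along an isotropic line `[σ + s n]`, with `σ = a + i b` and `n` real, isotropic and
orthogonal to `a, b`, costs nothing, and such moves connect any two points.

For the first claim, complete `n` to a hyperbolic pair `n, m` orthogonal to `a, b` and take the
conic `s ↦ [σ - μ s² σ̄ + s n + μ s m]`. On it `q(v, v̄) = 2 |1 + μ |s|²|²`, so for non-real `μ` the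
whole rational curve lies in `D`. Its curvature is positive on the unit disk as soon as `2 |μ|² ≤
-Re μ` (`griffithsSchmid_conic_pos`). Replacing `n, m` by `ε⁻¹ n, ε m` keeps these properties, while
the parameter `-ε` now gives a point within `O(ε²)` of `[σ - n]`. A second conic, starting at `[σ +
n]`, can be made to pass through exactly the same point, so `[σ]` and `[σ + n]` are joined by two
disks of total length `O(ε)` (`DiskContracting.le_of_conics`); let `ε → 0`.

For the second claim, points of `D` are orthonormal pairs up to rotation. Two pairs with a common
vector are joined by two isotropic moves (`DiskContracting.le_of_common`); this uses a negative
direction, hence `dim D ≥ 2`. Three positive directions then suffice to link arbitrary pairs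
(`DiskContracting.le`).

All estimates are made for an arbitrary `DiskContracting` function, so that they apply both to
`d_p(·, y)` and to the infimum over chains of rational disks. -/

theorem laplacian_log_quadratic {A : ℝ} (hA : 0 < A) (a b B : ℝ) :
    Laplacian.laplacian (fun z : ℂ =>
      Real.log (A + 2 * (a * z.re + b * z.im) + B * (z.re ^ 2 + z.im ^ 2))) 0
      = 4 * (B / A - (a ^ 2 + b ^ 2) / A ^ 2) := by
  set Q : ℂ → ℝ := fun z => A + 2 * (a * z.re + b * z.im) + B * (z.re ^ 2 + z.im ^ 2) with hQdef
  have hre (z : ℂ) : HasFDerivAt Complex.re Complex.reCLM z := Complex.reCLM.hasFDerivAt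
  have him (z : ℂ) : HasFDerivAt Complex.im Complex.imCLM z := Complex.imCLM.hasFDerivAt
  have hQ (z : ℂ) : HasFDerivAt Q
      ((2 * (a + B * z.re)) • Complex.reCLM + (2 * (b + B * z.im)) • Complex.imCLM) z := by
    have := (((((hre z).const_mul a).add ((him z).const_mul b)).const_mul 2).const_add A).add
      ((((hre z).pow 2).add ((him z).pow 2)).const_mul B)
    refine this.congr_fderiv ?_
    ext v
    simp
    ring
  have hQ0 : Q 0 = A := by simp [hQdef]
  have hcont : Continuous Q := by
    rw [continuous_iff_continuousAt]
    exact fun z => (hQ z).continuousAt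
  have hev : ∀ᶠ z in 𝓝 (0 : ℂ), Q z ≠ 0 :=
    hcont.continuousAt.eventually_ne (by rw [hQ0]; exact hA.ne')
  -- With `∇ log Q = ∇Q / Q` near `0`, one more differentiation at `0` gives `Δ log Q = ΔQ / Q -
  -- |∇Q|² / Q²`.
  have hfd : fderiv ℝ (fun z => Real.log (Q z)) =ᶠ[𝓝 0] fun z =>
      ((Q z)⁻¹ * (2 * (a + B * z.re))) • Complex.reCLM
        + ((Q z)⁻¹ * (2 * (b + B * z.im))) • Complex.imCLM := by
    filter_upwards [hev] with z hz
    rw [((hQ z).log hz).fderiv, smul_add, smul_smul, smul_smul]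
  have hinv : HasFDerivAt (fun z => (Q z)⁻¹)
      (-(A ^ 2)⁻¹ • ((2 * a) • Complex.reCLM + (2 * b) • Complex.imCLM)) (0 : ℂ) := by
    have := (hasDerivAt_inv (by rw [hQ0]; exact hA.ne' : Q 0 ≠ 0)).comp_hasFDerivAt (0 : ℂ) (hQ 0)
    rw [hQ0] at this
    simpa [Function.comp_def] using this
  have h2 := ((hinv.mul (((hre 0).const_mul B |>.const_add a).const_mul 2)).smul_const
      Complex.reCLM).add
    ((hinv.mul (((him 0).const_mul B |>.const_add b).const_mul 2)).smul_const Complex.imCLM)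
  rw [InnerProductSpace.laplacian_eq_iteratedFDeriv_complexPlane]
  simp only [iteratedFDeriv_two_apply]
  rw [hfd.fderiv_eq]
  erw [h2.fderiv]
  simp [hQ0]
  field_simp
  ring

/-! ### Extending scalars -/

theorem qC_tmul (c d : ℂ) (x y : H) : qC q (c ⊗ₜ x) (d ⊗ₜ y) = c * d * (q x y : ℂ) := by
  simp [qC, mul_comm]

theorem conj_tmul (c : ℂ) (x : H) : conj H (c ⊗ₜ x) = (starRingEnd ℂ c) ⊗ₜ x := by
  simp [conj]

theorem conj_smul (c : ℂ) (v : ℂ ⊗[ℝ] H) : conj H (c • v) = (starRingEnd ℂ c) • conj H v := by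
  induction v using TensorProduct.induction_on with
  | zero => simp
  | tmul d x => simp [conj_tmul, TensorProduct.smul_tmul']
  | add v w hv hw => simp [hv, hw]

theorem hermSq_smul (c : ℂ) (v : ℂ ⊗[ℝ] H) :
    hermSq q (c • v) = Complex.normSq c * hermSq q v := by
  have : qC q (c • v) (conj H (c • v)) = (Complex.normSq c : ℂ) * qC q v (conj H v) := by
    rw [conj_smul, Complex.normSq_eq_conj_mul_self]
    simp
    ring
  rw [hermSq, this, Complex.re_ofReal_mul, hermSq]

theorem hermSq_zero : hermSq q (0 : ℂ ⊗[ℝ] H) = 0 := by simp [hermSq]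

theorem exists_eq_re_add_im (v : ℂ ⊗[ℝ] H) :
    ∃ a b : H, v = (1 : ℂ) ⊗ₜ a + Complex.I ⊗ₜ b := by
  induction v using TensorProduct.induction_on with
  | zero => exact ⟨0, 0, by simp⟩
  | tmul c x =>
    refine ⟨c.re • x, c.im • x, ?_⟩
    rw [← TensorProduct.smul_tmul, ← TensorProduct.smul_tmul, ← TensorProduct.add_tmul]
    congr 1
    apply Complex.ext <;> simp
  | add v w hv hw =>
    obtain ⟨a, b, rfl⟩ := hv
    obtain ⟨c, d, rfl⟩ := hw
    exact ⟨a + c, b + d, by simp only [TensorProduct.tmul_add]; abel⟩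

/-! ### Points of the period domain -/

/-- The vectors spanning the lines of the period domain. -/
def IsPeriod (q : LinearMap.BilinForm ℝ H) (v : ℂ ⊗[ℝ] H) : Prop :=
  qC q v v = 0 ∧ 0 < hermSq q v

theorem IsPeriod.ne_zero {v : ℂ ⊗[ℝ] H} (hv : IsPeriod q v) : v ≠ 0 := by
  rintro rfl
  exact hv.2.ne' hermSq_zero

theorem IsPeriod.smul {v : ℂ ⊗[ℝ] H} (hv : IsPeriod q v) {c : ℂ} (hc : c ≠ 0) :
    IsPeriod q (c • v) := by
  refine ⟨by simp [hv.1], ?_⟩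
  rw [hermSq_smul]
  exact mul_pos (Complex.normSq_pos.2 hc) hv.2

/-- The point of the period domain spanned by a vector. -/
def point (v : ℂ ⊗[ℝ] H) (hv : IsPeriod q v) : periodDomain q :=
  ⟨Projectivization.mk ℂ v hv.ne_zero, v, hv.ne_zero, rfl, hv.1, hv.2⟩

theorem exists_eq_point (x : periodDomain q) : ∃ (v : ℂ ⊗[ℝ] H) (hv : IsPeriod q v),
    x = point v hv := by
  obtain ⟨_, v, hv, rfl, h⟩ := x
  exact ⟨v, h, rfl⟩

theorem point_eq_point {v w : ℂ ⊗[ℝ] H} (hv : IsPeriod q v) (hw : IsPeriod q w) (c : ℂ)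
    (h : v = c • w) : point v hv = point w hw := by
  apply Subtype.ext
  exact (Projectivization.mk_eq_mk_iff' ℂ v w hv.ne_zero hw.ne_zero).2 ⟨c, h.symm⟩

/-! ### Conics in the period domain of a subspace of signature `(3, 1)` -/

/-- A basis `a, b, n, m` of a subspace of signature `(3, 1)`: `a, b` is orthonormal, `n, m` is a
hyperbolic pair in its orthogonal complement. -/
structure NullFrame (q : LinearMap.BilinForm ℝ H) (a b n m : H) : Prop where
  aa : q a a = 1
  bb : q b b = 1
  ab : q a b = 0
  an : q a n = 0
  am : q a m = 0
  bn : q b n = 0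
  bm : q b m = 0
  nn : q n n = 0
  mm : q m m = 0
  nm : q n m = 2

/-- The vector `α σ + β σ̄ + γ n + δ m`, where `σ = a + i b`. -/
def frameVec (a b n m : H) (α β γ δ : ℂ) : ℂ ⊗[ℝ] H :=
  (α + β) ⊗ₜ a + (Complex.I * (α - β)) ⊗ₜ b + γ ⊗ₜ n + δ ⊗ₜ m

theorem conj_frameVec (a b n m : H) (α β γ δ : ℂ) :
    conj H (frameVec a b n m α β γ δ) = frameVec a b n m (starRingEnd ℂ β) (starRingEnd ℂ α)
      (starRingEnd ℂ γ) (starRingEnd ℂ δ) := by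
  simp only [frameVec, map_add, conj_tmul, map_mul, map_sub, Complex.conj_I]
  congr 4
  · ring
  · ring

theorem qC_frameVec (hq : q.IsSymm) {a b n m : H} (h : NullFrame q a b n m)
    (α β γ δ α' β' γ' δ' : ℂ) :
    qC q (frameVec a b n m α β γ δ) (frameVec a b n m α' β' γ' δ')
      = 2 * (α * β' + β * α') + 2 * (γ * δ' + δ * γ') := by
  have hs : ∀ x y, q x y = q y x := fun x y => hq.eq x y
  simp only [frameVec, map_add, LinearMap.add_apply, qC_tmul, h.aa, h.bb, h.ab, h.an, h.am, h.bn,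
    h.bm, h.nn, h.mm, h.nm, hs b a, hs n a, hs m a, hs n b, hs m b, hs m n]
  push_cast
  linear_combination (α - β) * (α' - β') * Complex.I_sq

theorem hermSq_frameVec (hq : q.IsSymm) {a b n m : H} (h : NullFrame q a b n m) (α β γ δ : ℂ) :
    hermSq q (frameVec a b n m α β γ δ)
      = 2 * (α.re ^ 2 + α.im ^ 2 + β.re ^ 2 + β.im ^ 2) + 4 * (γ.re * δ.re + γ.im * δ.im) := by
  rw [hermSq, conj_frameVec, qC_frameVec hq h]
  simp
  ring

theorem frameVec_add (a b n m : H) (α β γ δ α' β' γ' δ' : ℂ) :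
    frameVec a b n m α β γ δ + frameVec a b n m α' β' γ' δ'
      = frameVec a b n m (α + α') (β + β') (γ + γ') (δ + δ') := by
  simp only [frameVec, TensorProduct.add_tmul, mul_sub, mul_add, TensorProduct.sub_tmul]
  abel

theorem smul_frameVec (a b n m : H) (c α β γ δ : ℂ) :
    c • frameVec a b n m α β γ δ = frameVec a b n m (c * α) (c * β) (c * γ) (c * δ) := by
  simp only [frameVec, smul_add, TensorProduct.smul_tmul', smul_eq_mul]
  congr 4
  · ring
  · ring

/-- Holomorphy and tangent lifts are tested on linear forms; this reduces both to the four scalar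
coordinates. -/
theorem dual_frameVec (φ : Module.Dual ℂ (ℂ ⊗[ℝ] H)) (a b n m : H) (α β γ δ : ℂ) :
    φ (frameVec a b n m α β γ δ) = α * φ (frameVec a b n m 1 0 0 0)
      + β * φ (frameVec a b n m 0 1 0 0) + γ * φ (frameVec a b n m 0 0 1 0)
      + δ * φ (frameVec a b n m 0 0 0 1) := by
  simp only [← smul_eq_mul, ← map_smul, ← map_add, smul_frameVec, frameVec_add]
  simp

/-- A parametrization of a conic, of bidegree `(1, 1)` in the quadric `ℙ¹ × ℙ¹` of the subspace
spanned by `a, b, n, m`. -/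
def conicVec (a b n m : H) (μ s t : ℂ) : ℂ ⊗[ℝ] H :=
  frameVec a b n m (t ^ 2) (-μ * s ^ 2) (s * t) (μ * (s * t))

theorem conicVec_mul (a b n m : H) (μ c s t : ℂ) :
    conicVec a b n m μ (c * s) (c * t) = c ^ 2 • conicVec a b n m μ s t := by
  rw [conicVec, conicVec, smul_frameVec]
  congr 1 <;> ring

theorem conicVec_zero (a b n m : H) (μ : ℂ) :
    conicVec a b n m μ 0 1 = (1 : ℂ) ⊗ₜ a + Complex.I ⊗ₜ b := by
  simp [conicVec, frameVec]

theorem isPeriod_conicVec (hq : q.IsSymm) {a b n m : H} (h : NullFrame q a b n m) {μ s t : ℂ}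
    (hμ : μ.im ≠ 0) (hst : s ≠ 0 ∨ t ≠ 0) : IsPeriod q (conicVec a b n m μ s t) := by
  constructor
  · rw [conicVec, qC_frameVec hq h]
    ring
  · have key : hermSq q (conicVec a b n m μ s t) = 2 *
        ((Complex.normSq t + μ.re * Complex.normSq s) ^ 2 + (μ.im * Complex.normSq s) ^ 2) := by
      rw [conicVec, hermSq_frameVec hq h]
      simp [pow_two, Complex.normSq_apply]
      ring
    rw [key]
    refine mul_pos two_pos ((add_nonneg (sq_nonneg _) (sq_nonneg _)).lt_of_ne' fun h0 => ?_)
    have h1 := pow_eq_zero_iff two_ne_zero |>.1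
      ((add_eq_zero_iff_of_nonneg (sq_nonneg _) (sq_nonneg _)).1 h0).1
    have h2 := pow_eq_zero_iff two_ne_zero |>.1
      ((add_eq_zero_iff_of_nonneg (sq_nonneg _) (sq_nonneg _)).1 h0).2
    have hs := (mul_eq_zero.1 h2).resolve_left hμ
    rw [hs, mul_zero, add_zero] at h1
    exact hst.elim (fun h => h (Complex.normSq_eq_zero.1 hs))
      (fun h => h (Complex.normSq_eq_zero.1 h1))

theorem rep_ne_zero (l : ℙ ℂ (Fin 2 → ℂ)) : l.rep 0 ≠ 0 ∨ l.rep 1 ≠ 0 := by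
  by_contra! h
  apply l.rep_nonzero
  ext i
  fin_cases i
  · exact h.1
  · exact h.2

/-- The rational curve in the period domain parametrized by `conicVec`. -/
def conic (hq : q.IsSymm) {a b n m : H} (h : NullFrame q a b n m) {μ : ℂ} (hμ : μ.im ≠ 0)
    (l : ℙ ℂ (Fin 2 → ℂ)) : periodDomain q :=
  point (conicVec a b n m μ (l.rep 0) (l.rep 1)) (isPeriod_conicVec hq h hμ (rep_ne_zero l))

/-- Independence of the representative: `conicVec` is homogeneous of degree 2 in `(s, t)`. -/
theorem conic_mk (hq : q.IsSymm) {a b n m : H} (h : NullFrame q a b n m) {μ : ℂ} (hμ : μ.im ≠ 0)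
    {v : Fin 2 → ℂ} (hv : v ≠ 0) (hst : v 0 ≠ 0 ∨ v 1 ≠ 0) :
    conic hq h hμ (Projectivization.mk ℂ v hv)
      = point (conicVec a b n m μ (v 0) (v 1)) (isPeriod_conicVec hq h hμ hst) := by
  obtain ⟨c, hc⟩ := Projectivization.exists_smul_eq_mk_rep ℂ v hv
  refine point_eq_point _ _ ((c : ℂ) ^ 2) ?_
  rw [← conicVec_mul, ← hc]
  rfl

theorem conic_chartZero (hq : q.IsSymm) {a b n m : H} (h : NullFrame q a b n m) {μ : ℂ}
    (hμ : μ.im ≠ 0) (z : ℂ) : conic hq h hμ (chartZero z)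
      = point (conicVec a b n m μ z 1) (isPeriod_conicVec hq h hμ (Or.inr one_ne_zero)) :=
  conic_mk hq h hμ _ (Or.inr one_ne_zero)

theorem conic_chartInfty (hq : q.IsSymm) {a b n m : H} (h : NullFrame q a b n m) {μ : ℂ}
    (hμ : μ.im ≠ 0) (z : ℂ) : conic hq h hμ (chartInfty z)
      = point (conicVec a b n m μ 1 z) (isPeriod_conicVec hq h hμ (Or.inl one_ne_zero)) :=
  conic_mk hq h hμ _ (Or.inl one_ne_zero)

theorem holomorphicAt_frameVec (a b n m : H) {α β γ δ : ℂ → ℂ} {z₀ : ℂ}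
    (hα : AnalyticAt ℂ α z₀) (hβ : AnalyticAt ℂ β z₀) (hγ : AnalyticAt ℂ γ z₀)
    (hδ : AnalyticAt ℂ δ z₀) :
    HolomorphicAt (fun z => frameVec a b n m (α z) (β z) (γ z) (δ z)) z₀ := by
  intro φ
  simp only [dual_frameVec φ a b n m (α _)]
  fun_prop

theorem isLocalLift_chartZero (hq : q.IsSymm) {a b n m : H} (h : NullFrame q a b n m) {μ : ℂ}
    (hμ : μ.im ≠ 0) (z₀ : ℂ) :
    IsLocalLift (fun z => (conic hq h hμ (chartZero z) : ℙ ℂ (ℂ ⊗[ℝ] H))) z₀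
      (fun z => conicVec a b n m μ z 1) := by
  refine ⟨holomorphicAt_frameVec a b n m (by fun_prop) (by fun_prop) (by fun_prop) (by fun_prop),
    Filter.Eventually.of_forall fun z => ?_⟩
  exact ⟨(isPeriod_conicVec hq h hμ (Or.inr one_ne_zero)).ne_zero,
    congrArg Subtype.val (conic_chartZero hq h hμ z)⟩

theorem isLocalLift_chartInfty (hq : q.IsSymm) {a b n m : H} (h : NullFrame q a b n m) {μ : ℂ}
    (hμ : μ.im ≠ 0) (z₀ : ℂ) :
    IsLocalLift (fun z => (conic hq h hμ (chartInfty z) : ℙ ℂ (ℂ ⊗[ℝ] H))) z₀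
      (fun z => conicVec a b n m μ 1 z) := by
  refine ⟨holomorphicAt_frameVec a b n m (by fun_prop) (by fun_prop) (by fun_prop) (by fun_prop),
    Filter.Eventually.of_forall fun z => ?_⟩
  exact ⟨(isPeriod_conicVec hq h hμ (Or.inl one_ne_zero)).ne_zero,
    congrArg Subtype.val (conic_chartInfty hq h hμ z)⟩

theorem extendsToRationalCurve_conic (hq : q.IsSymm) {a b n m : H} (h : NullFrame q a b n m)
    {μ : ℂ} (hμ : μ.im ≠ 0) :
    ExtendsToRationalCurve q (fun z => conic hq h hμ (chartZero z)) :=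
  ⟨conic hq h hμ, fun z _ => ⟨_, isLocalLift_chartZero hq h hμ z⟩,
    fun z _ => ⟨_, isLocalLift_chartInfty hq h hμ z⟩, fun _ _ => rfl⟩

/-- The derivative of `z ↦ conicVec a b n m μ z 1`. -/
def conicTangent (a b n m : H) (μ z : ℂ) : ℂ ⊗[ℝ] H :=
  frameVec a b n m 0 (-μ * (2 * z)) 1 μ

theorem conicTangent_notMem_span (hq : q.IsSymm) {a b n m : H} (h : NullFrame q a b n m)
    (μ z : ℂ) : conicTangent a b n m μ z ∉ Submodule.span ℂ {conicVec a b n m μ z 1} := by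
  rw [Submodule.mem_span_singleton]
  rintro ⟨c, hc⟩
  -- Pairing with `σ̄` and with `m` reads off the coordinates along `σ` and `n`. These are `1, z`
  -- for the curve and `0, 1` for its derivative.
  have h1 := congrArg (fun v => qC q v (frameVec a b n m 0 1 0 0)) hc
  have h2 := congrArg (fun v => qC q v (frameVec a b n m 0 0 0 1)) hc
  simp [conicVec, conicTangent, smul_frameVec, qC_frameVec hq h] at h1 h2
  simp [h1] at h2

theorem isTangentLift_conic (hq : q.IsSymm) {a b n m : H} (h : NullFrame q a b n m) {μ : ℂ}
    (hμ : μ.im ≠ 0) (z₀ : ℂ) :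
    IsTangentLift (fun z => (conic hq h hμ (chartZero z) : ℙ ℂ (ℂ ⊗[ℝ] H))) z₀
      (conicVec a b n m μ z₀ 1) (conicTangent a b n m μ z₀) := by
  -- The exponent is `0`: the conic is immersed, and the tangent vector is the honest derivative of
  -- the lift.
  refine ⟨fun z => conicVec a b n m μ z 1, conicTangent a b n m μ, 0,
    isLocalLift_chartZero hq h hμ z₀,
    holomorphicAt_frameVec a b n m (by fun_prop) (by fun_prop) (by fun_prop) (by fun_prop),
    Filter.Eventually.of_forall fun z φ _ => ?_, rfl, rfl, conicTangent_notMem_span hq h μ z₀⟩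
  simp only [conicVec, conicTangent, dual_frameVec φ a b n m (_ ^ 2),
    dual_frameVec φ a b n m 0 (_ * _) 1 μ, pow_zero, one_mul]
  have h1 : HasDerivAt (fun ζ : ℂ => -μ * ζ ^ 2) (-μ * (2 * z)) z := by
    simpa using (hasDerivAt_pow 2 z).const_mul (-μ)
  have h2 : HasDerivAt (fun ζ : ℂ => ζ * 1) 1 z :=
    ((hasDerivAt_id z).mul_const 1).congr_deriv (one_mul 1)
  have h3 : HasDerivAt (fun ζ : ℂ => μ * (ζ * 1)) μ z :=
    (h2.const_mul μ).congr_deriv (mul_one μ)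
  have := ((((h1.mul_const (φ (frameVec a b n m 0 1 0 0))).const_add
    (1 ^ 2 * φ (frameVec a b n m 1 0 0 0))).add
    (h2.mul_const (φ (frameVec a b n m 0 0 1 0)))).add
    (h3.mul_const (φ (frameVec a b n m 0 0 0 1)))).deriv
  refine Eq.trans this ?_
  ring

theorem griffithsSchmid_conic_pos (hq : q.IsSymm) {a b n m : H} (h : NullFrame q a b n m) {μ : ℂ}
    (hμ : μ.im ≠ 0) (hle : 2 * Complex.normSq μ ≤ -μ.re) {z : ℂ} (hz : z ∈ disk) :
    0 < griffithsSchmid q (conicVec a b n m μ z 1) (conicTangent a b n m μ z) := by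
  set N := Complex.normSq μ with hN
  set r := Complex.normSq z with hr
  have hNpos : 0 < N := Complex.normSq_pos.2 fun h0 => hμ (by simp [h0])
  have hr0 : 0 ≤ r := Complex.normSq_nonneg z
  have hr1 : r < 1 := by
    rw [hr, Complex.normSq_eq_norm_sq]
    have : ‖z‖ < 1 := by simpa using hz
    nlinarith [norm_nonneg z]
  set A := 2 + 2 * N * r ^ 2 + 4 * μ.re * r with hA
  have hApos : 0 < A := by
    have := (isPeriod_conicVec hq h hμ (s := z) (t := 1) (Or.inr one_ne_zero)).2
    rw [conicVec, hermSq_frameVec hq h] at this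
    simp [pow_two] at this
    rw [hA, hN, hr, Complex.normSq_apply, Complex.normSq_apply]
    linarith
  set k := 4 * N * r + 4 * μ.re with hk
  have hfun : (fun ζ : ℂ => Real.log (hermSq q
      (conicVec a b n m μ z 1 + ζ • conicTangent a b n m μ z))) = fun ζ : ℂ =>
      Real.log (A + 2 * (k * z.re * ζ.re + k * z.im * ζ.im)
        + (8 * N * r + 4 * μ.re) * (ζ.re ^ 2 + ζ.im ^ 2)) := by
    funext ζ
    refine congrArg Real.log ?_
    rw [conicVec, conicTangent, smul_frameVec, frameVec_add, hermSq_frameVec hq h]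
    simp [pow_two, hA, hk, hN, hr, Complex.normSq_apply]
    ring
  rw [griffithsSchmid, hfun, laplacian_log_quadratic hApos]
  have hrz : z.re ^ 2 + z.im ^ 2 = r := by
    rw [hr, Complex.normSq_apply]
    ring
  -- Up to the factor `A²`, this is minus a quarter of the Laplacian; its sign is that of `-(Re μ (1
  -- + N r²) + 2 N r)`.
  have key : ((k * z.re) ^ 2 + (k * z.im) ^ 2) - A * (8 * N * r + 4 * μ.re)
      = -8 * (μ.re * (1 + N * r ^ 2) + 2 * N * r) := by
    rw [show (k * z.re) ^ 2 + (k * z.im) ^ 2 = k ^ 2 * r by rw [← hrz]; ring, hk, hA]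
    ring
  -- Since `Re μ ≤ -2N`, the sum `Re μ + 2 N r` is at most `2N (r - 1) < 0`.
  have hneg : μ.re * (1 + N * r ^ 2) + 2 * N * r < 0 := by
    have h1 : μ.re * (N * r ^ 2) ≤ 0 :=
      mul_nonpos_of_nonpos_of_nonneg (by linarith) (by positivity)
    nlinarith
  have : -(1 / 4) * (4 * ((8 * N * r + 4 * μ.re) / A - ((k * z.re) ^ 2 + (k * z.im) ^ 2) / A ^ 2))
      = (((k * z.re) ^ 2 + (k * z.im) ^ 2) - A * (8 * N * r + 4 * μ.re)) / A ^ 2 := by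
    field_simp
    ring
  rw [this, key]
  apply div_pos
  · linarith
  · positivity

theorem isPositiveDisk_conic (hq : q.IsSymm) {a b n m : H} (h : NullFrame q a b n m) {μ : ℂ}
    (hμ : μ.im ≠ 0) (hle : 2 * Complex.normSq μ ≤ -μ.re) :
    IsPositiveDisk q (fun z => conic hq h hμ (chartZero z)) := by
  refine ⟨fun z _ => ⟨_, isLocalLift_chartZero hq h hμ z⟩, ⟨0, by simp, 1 / 2, ?_, ?_⟩,
    fun z hz => ⟨_, _, isTangentLift_conic hq h hμ z, griffithsSchmid_conic_pos hq h hμ hle hz⟩⟩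
  · rw [mem_ball_zero_iff]
    norm_num
  · intro heq
    rw [conic_chartZero, conic_chartZero] at heq
    obtain ⟨c, hc⟩ := (Projectivization.mk_eq_mk_iff' ..).1 (congrArg Subtype.val heq)
    have h1 := congrArg (fun v => qC q v (frameVec a b n m 0 1 0 0)) hc
    have h2 := congrArg (fun v => qC q v (frameVec a b n m 0 0 0 1)) hc
    simp [conicVec, smul_frameVec, qC_frameVec hq h] at h1 h2
    simp [h1] at h2

/-! ### Orthonormal pairs -/

/-- An orthonormal pair of vectors. -/
structure OrthoPair (q : LinearMap.BilinForm ℝ H) (a b : H) : Prop where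
  aa : q a a = 1
  bb : q b b = 1
  ab : q a b = 0

theorem qC_re_add_im (hq : q.IsSymm) (a b : H) :
    qC q ((1 : ℂ) ⊗ₜ a + Complex.I ⊗ₜ b) ((1 : ℂ) ⊗ₜ a + Complex.I ⊗ₜ b)
      = (q a a - q b b : ℝ) + (2 * q a b : ℝ) * Complex.I := by
  simp only [map_add, LinearMap.add_apply, qC_tmul, show q b a = q a b from hq.eq b a]
  push_cast
  linear_combination (q b b : ℂ) * Complex.I_sq

theorem hermSq_re_add_im (a b : H) :
    hermSq q ((1 : ℂ) ⊗ₜ a + Complex.I ⊗ₜ b) = q a a + q b b := by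
  rw [hermSq]
  simp only [map_add, conj_tmul, LinearMap.add_apply, qC_tmul]
  simp

theorem OrthoPair.isPeriod (hq : q.IsSymm) {a b : H} (h : OrthoPair q a b) :
    IsPeriod q ((1 : ℂ) ⊗ₜ a + Complex.I ⊗ₜ b) := by
  refine ⟨?_, ?_⟩
  · rw [qC_re_add_im hq, h.aa, h.bb, h.ab]
    simp
  · rw [hermSq_re_add_im, h.aa, h.bb]
    norm_num

theorem OrthoPair.rotate (hq : q.IsSymm) {a b : H} (h : OrthoPair q a b) (s t : ℝ)
    (hst : s ^ 2 + t ^ 2 = 1) : OrthoPair q (s • a - t • b) (t • a + s • b) := by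
  have hba : q b a = 0 := (hq.eq b a).trans h.ab
  constructor <;>
    simp only [map_add, map_sub, map_smul, LinearMap.add_apply, LinearMap.sub_apply,
      LinearMap.smul_apply, smul_eq_mul, h.aa, h.bb, h.ab, hba]
  · linear_combination hst
  · linear_combination hst
  · ring

/-- The point `[a + i b]` of the period domain attached to an orthonormal pair. -/
def OrthoPair.point (hq : q.IsSymm) {a b : H} (h : OrthoPair q a b) : periodDomain q :=
  K3Period.point _ (h.isPeriod hq)

theorem real_smul_tmul (x : H) (r : ℝ) : (1 : ℂ) ⊗ₜ[ℝ] (r • x) = (r : ℂ) • ((1 : ℂ) ⊗ₜ[ℝ] x) := by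
  rw [TensorProduct.smul_tmul', ← TensorProduct.smul_tmul]
  simp

theorem tmul_eq_smul (c : ℂ) (x : H) : c ⊗ₜ[ℝ] x = c • ((1 : ℂ) ⊗ₜ[ℝ] x) := by
  simp [TensorProduct.smul_tmul']

theorem OrthoPair.point_rotate (hq : q.IsSymm) {a b : H} (h : OrthoPair q a b) (s t : ℝ)
    (hst : s ^ 2 + t ^ 2 = 1) : (h.rotate hq s t hst).point hq = h.point hq := by
  refine point_eq_point _ _ (s + t * Complex.I) ?_
  simp only [tmul_eq_smul Complex.I, TensorProduct.tmul_add, TensorProduct.tmul_sub,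
    real_smul_tmul]
  match_scalars
  · ring
  · linear_combination (-t : ℂ) * Complex.I_sq

theorem exists_eq_orthoPair_point (hq : q.IsSymm) (x : periodDomain q) :
    ∃ (a b : H) (h : OrthoPair q a b), x = h.point hq := by
  obtain ⟨v, hv, rfl⟩ := exists_eq_point x
  obtain ⟨a, b, rfl⟩ := exists_eq_re_add_im v
  obtain ⟨h0, hpos⟩ := hv
  have h0' := h0
  rw [qC_re_add_im hq] at h0
  rw [hermSq_re_add_im] at hpos
  have h1 : q a a - q b b = 0 := by simpa using congrArg Complex.re h0
  have h2 : q a b = 0 := by simpa using congrArg Complex.im h0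
  have ha : 0 < q a a := by linarith
  set s := (Real.sqrt (q a a))⁻¹ with hs
  have hs0 : s ≠ 0 := inv_ne_zero (Real.sqrt_pos.2 ha).ne'
  have hsa : s * (s * q a a) = 1 := by
    rw [hs]
    field_simp
    rw [Real.sq_sqrt ha.le]
  refine ⟨s • a, s • b, ⟨by simpa using hsa, ?_, by simp [h2]⟩, ?_⟩
  · rw [sub_eq_zero] at h1
    rw [h1] at hsa
    simpa using hsa
  · refine point_eq_point _ _ ((s : ℂ)⁻¹) ?_
    have : (s : ℂ) ≠ 0 := by exact_mod_cast hs0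
    rw [tmul_eq_smul Complex.I (s • b), real_smul_tmul, real_smul_tmul, tmul_eq_smul Complex.I b]
    match_scalars <;> field_simp

/-! ### Functions that are contracting along positive disks of rational curves -/

/-- Functions on the period domain that increase by at most the Poincaré distance along the
positive disks that extend to rational curves. -/
def DiskContracting (q : LinearMap.BilinForm ℝ H) (g : periodDomain q → ℝ≥0∞) : Prop :=
  ∀ f, IsPositiveDisk q f → ExtendsToRationalCurve q f → ∀ a ∈ disk, ∀ b ∈ disk,
    g (f a) ≤ poincareDist a b + g (f b)

theorem DiskContracting.le_conic (hq : q.IsSymm) {g : periodDomain q → ℝ≥0∞}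
    (hg : DiskContracting q g) {a b n m : H} (h : NullFrame q a b n m) {μ : ℂ}
    (hμ : μ.im ≠ 0) (hle : 2 * Complex.normSq μ ≤ -μ.re) {z w : ℂ} (hz : z ∈ disk)
    (hw : w ∈ disk) :
    g (point _ (isPeriod_conicVec hq h hμ (s := z) (t := 1) (Or.inr one_ne_zero)))
      ≤ poincareDist z w
        + g (point _ (isPeriod_conicVec hq h hμ (s := w) (t := 1) (Or.inr one_ne_zero))) := by
  have := hg _ (isPositiveDisk_conic hq h hμ hle) (extendsToRationalCurve_conic hq h hμ) z hz w hw
  rwa [conic_chartZero, conic_chartZero] at this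

theorem poincareDist_zero_left (z : ℂ) :
    poincareDist 0 z = ENNReal.ofReal (2 * Real.artanh ‖z‖) := by
  simp [poincareDist]

theorem poincareDist_zero_right (z : ℂ) :
    poincareDist z 0 = ENNReal.ofReal (2 * Real.artanh ‖z‖) := by
  simp [poincareDist]

theorem NullFrame.rescale {a b n m : H} (h : NullFrame q a b n m) {ε : ℝ}
    (hε : ε ≠ 0) : NullFrame q a b (ε⁻¹ • n) (ε • m) := by
  constructor <;> simp [h.aa, h.bb, h.ab, h.an, h.am, h.bn, h.bm, h.nn, h.mm, h.nm, hε]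

/-- The image of a frame under the unipotent isometry that fixes `n` and `b` and maps
`a` to `a + n`. -/
theorem NullFrame.transvect (hq : q.IsSymm) {a b n m : H} (h : NullFrame q a b n m) :
    NullFrame q (a + n) b n (m - (2 : ℝ) • a - n) := by
  have hs : ∀ x y, q x y = q y x := fun x y => hq.eq x y
  constructor <;>
    simp [h.aa, h.bb, h.ab, h.an, h.am, h.bn, h.bm, h.nn, h.mm, h.nm, hs b a, hs n a, hs m a,
      hs n b, hs m n] <;> norm_num

/-- A two-step chain of positive disks on conics from `[a + i b]` to `[a + n + i b]`. -/
theorem DiskContracting.le_of_conics (hq : q.IsSymm) {g : periodDomain q → ℝ≥0∞}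
    (hg : DiskContracting q g) {a b n m : H} (h : NullFrame q a b n m) (hp : OrthoPair q a b)
    (hp' : OrthoPair q (a + n) b) {ε : ℝ} (hε : 0 < ε) (hε' : ε < 1 / 2) :
    g (hp.point hq) ≤ ENNReal.ofReal (2 * Real.artanh ε)
      + (ENNReal.ofReal (2 * Real.artanh (2 * ε)) + g (hp'.point hq)) := by
  set e := ε ^ 2 with he
  have he0 : 0 < e := by positivity
  have he1 : e < 1 := by nlinarith
  set d := (1 - e / 6) ^ 2 + (e / 6) ^ 2 with hd
  have hd0 : 0 < d := by
    have : 0 < 1 - e / 6 := by linarith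
    positivity
  -- The second conic has parameter `ν`, the first `μ = 2ν / (1 + 2νe)`, the value forced by their
  -- meeting. The choice `ν = (-1 + i) / 12` makes both satisfy the positivity bound for all `e <
  -- 1`; `d` is `|1 + 2νe|²`.
  set ν : ℂ := ⟨-1 / 12, 1 / 12⟩ with hν
  set c : ℂ := ⟨(1 - e / 6) / d, -(e / 6) / d⟩ with hc
  have hcν : c * (1 + 2 * ν * e) = 1 := by
    apply Complex.ext <;> simp [hc, hν] <;> field_simp <;> rw [hd] <;> ring
  set μ : ℂ := 2 * ν * c with hμ
  have hμre : μ.re = (-1 / 6 + e / 18) / d := by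
    simp [hμ, hν, hc]
    field_simp
    ring
  have hμim : μ.im = 1 / 6 / d := by
    simp [hμ, hν, hc]
    field_simp
    ring
  have hμ0 : μ.im ≠ 0 := by
    rw [hμim]
    positivity
  have hμle : 2 * Complex.normSq μ ≤ -μ.re := by
    have : Complex.normSq μ = 1 / 18 / d := by
      rw [Complex.normSq_apply, hμre, hμim]
      field_simp
      rw [hd]
      ring
    rw [this, hμre, ← neg_div, ← mul_div_assoc]
    gcongr
    linarith
  have hν0 : ν.im ≠ 0 := by norm_num [hν]
  have hνle : 2 * Complex.normSq ν ≤ -ν.re := by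
    rw [Complex.normSq_apply]
    norm_num [hν]
  have h1 := h.rescale hε.ne'
  have h2 := (h.transvect hq).rescale hε.ne'
  have hz : (-ε : ℂ) ∈ disk := by
    simp [abs_of_pos hε]
    linarith
  have hw : (-(2 * ε) : ℂ) ∈ disk := by
    simp [abs_of_pos hε]
    linarith
  -- Substituting `σ' = σ + n`, `m' = m - 2a - n` and `2a = σ + σ̄`, the second vector becomes `(1 +
  -- 2νe) (σ - μ e σ̄ - n - μ e m)`, which is `c⁻¹` times the first.
  have hmeet : point _ (isPeriod_conicVec hq h1 hμ0 (s := -ε) (t := 1) (Or.inr one_ne_zero))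
      = point _ (isPeriod_conicVec hq h2 hν0 (s := -(2 * ε)) (t := 1) (Or.inr one_ne_zero)) := by
    refine point_eq_point _ _ c ?_
    have hεε : (ε : ℂ) * (ε : ℂ)⁻¹ = 1 := mul_inv_cancel₀ (by exact_mod_cast hε.ne')
    have hee : (e : ℂ) = (ε : ℂ) ^ 2 := by rw [he]; push_cast; rfl
    rw [hee] at hcν
    simp only [conicVec, frameVec, tmul_eq_smul (_ + _), tmul_eq_smul (_ * _), real_smul_tmul,
      TensorProduct.tmul_add, TensorProduct.tmul_sub, hμ]
    match_scalars
    · linear_combination (-1 : ℂ) * hcν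
    · linear_combination (-Complex.I) * hcν
    · linear_combination (-1 + 2 * c) * hεε + hcν
    · ring
  have k1 := hg.le_conic hq h1 hμ0 hμle (z := 0) (by simp) hz
  have k2 := hg.le_conic hq h2 hν0 hνle (w := 0) hw (by simp)
  rw [poincareDist_zero_left] at k1
  rw [poincareDist_zero_right] at k2
  rw [hmeet] at k1
  have e1 : point _ (isPeriod_conicVec hq h1 hμ0 (s := 0) (t := 1) (Or.inr one_ne_zero))
      = hp.point hq := point_eq_point _ _ 1 (by rw [conicVec_zero, one_smul])
  have e2 : point _ (isPeriod_conicVec hq h2 hν0 (s := 0) (t := 1) (Or.inr one_ne_zero))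
      = hp'.point hq := point_eq_point _ _ 1 (by rw [conicVec_zero, one_smul])
  rw [e1] at k1
  rw [e2] at k2
  have n1 : ‖(-ε : ℂ)‖ = ε := by simp [abs_of_pos hε]
  have n2 : ‖(-(2 * ε) : ℂ)‖ = 2 * ε := by simp [abs_of_pos hε]
  rw [n1] at k1
  rw [n2] at k2
  exact k1.trans (by gcongr)

theorem continuousAt_artanh_zero : ContinuousAt Real.artanh 0 := by
  unfold Real.artanh
  have : ContinuousAt (fun x : ℝ => Real.sqrt ((1 + x) / (1 - x))) 0 :=
    (ContinuousAt.div (by fun_prop) (by fun_prop) (by norm_num)).sqrt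
  exact this.log (by norm_num)

theorem DiskContracting.le_of_nullFrame (hq : q.IsSymm) {g : periodDomain q → ℝ≥0∞}
    (hg : DiskContracting q g) {a b n m : H} (h : NullFrame q a b n m) (hp : OrthoPair q a b)
    (hp' : OrthoPair q (a + n) b) : g (hp.point hq) ≤ g (hp'.point hq) := by
  have h1 : Filter.Tendsto (fun ε : ℝ => ENNReal.ofReal (2 * Real.artanh ε)) (𝓝 0) (𝓝 0) := by
    have := ENNReal.tendsto_ofReal (continuousAt_artanh_zero.tendsto.const_mul 2)
    simpa using this
  have h2 : Filter.Tendsto (fun ε : ℝ => ENNReal.ofReal (2 * Real.artanh (2 * ε))) (𝓝 0) (𝓝 0) :=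
    h1.comp (by simpa using (continuous_const_mul (2 : ℝ)).tendsto 0)
  have h3 := (h1.add (h2.add_const (g (hp'.point hq)))).mono_left
    (nhdsWithin_le_nhds : 𝓝[>] (0 : ℝ) ≤ 𝓝 0)
  rw [zero_add, zero_add] at h3
  refine ge_of_tendsto h3 ?_
  filter_upwards [Ioo_mem_nhdsGT (show (0 : ℝ) < 1 / 2 by norm_num)] with ε hε
  exact hg.le_of_conics hq h hp hp' hε.1 hε.2

theorem exists_nullFrame (hq : q.IsSymm) (hn : q.Nondegenerate) {a b n : H}
    (hp : OrthoPair q a b) (han : q a n = 0) (hbn : q b n = 0) (hnn : q n n = 0) (h0 : n ≠ 0) :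
    ∃ m, NullFrame q a b n m := by
  have hs : ∀ x y, q x y = q y x := fun x y => hq.eq x y
  obtain ⟨t, ht⟩ : ∃ t, q n t ≠ 0 := by
    by_contra! hall
    exact h0 (hn.1 n hall)
  set t' := t - q a t • a - q b t • b with ht'
  have hat : q a t' = 0 := by simp [ht', hp.aa, hp.ab]
  have hbt : q b t' = 0 := by simp [ht', hp.bb, hs b a, hp.ab]
  have hnt : q n t' = q n t := by simp [ht', hs n a, hs n b, han, hbn]
  set k := q n t with hk
  set u := (2 / k) • t' with hu
  have hau : q a u = 0 := by simp [hu, hat]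
  have hbu : q b u = 0 := by simp [hu, hbt]
  have hnu : q n u = 2 := by simp [hu, hnt]; field_simp
  -- Since `q n u = 2`, subtracting `λ n` lowers `q u u` by `4 λ`.
  refine ⟨u - (q u u / 4) • n, hp.aa, hp.bb, hp.ab, han, ?_, hbn, ?_, hnn, ?_, ?_⟩
  · simp [hau, han]
  · simp [hbu, hbn]
  · simp [hnn, hs u n, hnu]
    ring
  · simp [hnn, hnu]

/-- Moving along an isotropic line of the period domain costs nothing. -/
theorem DiskContracting.le_of_null (hq : q.IsSymm) (hn : q.Nondegenerate)
    {g : periodDomain q → ℝ≥0∞} (hg : DiskContracting q g) {a a' b : H} (hp : OrthoPair q a b)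
    (hp' : OrthoPair q a' b) (h1 : q a a' = 1) : g (hp.point hq) ≤ g (hp'.point hq) := by
  have hs : ∀ x y, q x y = q y x := fun x y => hq.eq x y
  obtain ⟨n, rfl⟩ : ∃ n, a' = a + n := ⟨a' - a, by abel⟩
  by_cases h0 : n = 0
  · subst h0
    simp
  have han : q a n = 0 := by simpa [hp.aa] using h1
  have hnb : q n b = 0 := by simpa [hp.ab] using hp'.ab
  have hnn : q n n = 0 := by simpa [hp.aa, hs n a, han] using hp'.aa
  obtain ⟨m, hm⟩ := exists_nullFrame hq hn hp han ((hs b n).trans hnb) hnn h0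
  exact hg.le_of_nullFrame hq hm hp hp'

/-! ### Connecting orthonormal pairs -/

/-- Two linear conditions on a positive definite 3-space leave a nonzero vector. -/
theorem exists_unit_orthogonal [FiniteDimensional ℝ H]
    (hpos : sigPos q.toQuadraticMap = 3) (v w : H) :
    ∃ u, q u u = 1 ∧ q v u = 0 ∧ q w u = 0 := by
  obtain ⟨W, hW, hdef⟩ := exists_finrank_eq_sigPos_and_posDef q.toQuadraticMap
  rw [hpos] at hW
  have hlt : Module.finrank ℝ (ℝ × ℝ) < Module.finrank ℝ W := by simp [hW]
  obtain ⟨x, hx, hx0⟩ := Submodule.exists_mem_ne_zero_of_ne_bot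
    (LinearMap.ker_ne_bot_of_finrank_lt (f := ((q v).prod (q w)).comp W.subtype) hlt)
  have hx' : q v x = 0 ∧ q w x = 0 := by simpa using hx
  have hxx : 0 < q (x : H) x := by simpa using hdef x hx0
  set s := (Real.sqrt (q (x : H) x))⁻¹ with hs
  refine ⟨s • (x : H), ?_, by simp [hx'.1], by simp [hx'.2]⟩
  have : s * (s * q (x : H) x) = 1 := by
    rw [hs]
    field_simp
    rw [Real.sq_sqrt hxx.le]
  simpa using this

theorem exists_neg (hq : q.IsSymm) (hn : q.Nondegenerate) [FiniteDimensional ℝ H]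
    (hpos : sigPos q.toQuadraticMap = 3) (hdim : 2 ≤ dim q) : ∃ e, q e e < 0 := by
  have hrad : q.toQuadraticMap.radical = ⊥ := by
    refine (Submodule.eq_bot_iff _).2 fun x hx => hn.1 x fun y => ?_
    have h := LinearMap.congr_fun (QuadraticMap.radical_le_ker_polarBilin hx) y
    simp [QuadraticMap.polar] at h
    linarith [hq.eq x y]
  have hsum := QuadraticForm.sigPos_add_sigNeg_add_radical (Q := q.toQuadraticMap)
  rw [hrad, finrank_bot, hpos] at hsum
  obtain ⟨W, hW, hdef⟩ := exists_finrank_eq_sigNeg_and_negDef q.toQuadraticMap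
  have hpos' : 0 < Module.finrank ℝ W := by
    rw [hW]
    rw [dim] at hdim
    omega
  have : Nontrivial W := Module.finrank_pos_iff.1 hpos'
  obtain ⟨x, hx⟩ := exists_ne (0 : W)
  exact ⟨x, by simpa using hdef x hx⟩

/-- Orthogonal projection off `a`, `b` and `a' - β a`, where `β = q a a'`. These are pairwise
orthogonal, and the last has square `1 - β²`. -/
theorem exists_projection (hq : q.IsSymm) {a a' b : H} (hp : OrthoPair q a b)
    (hp' : OrthoPair q a' b) (hβ : q a a' ^ 2 ≠ 1) (e : H) :
    ∃ m, q a m = 0 ∧ q a' m = 0 ∧ q b m = 0 ∧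
      q m m = q e e - q a e ^ 2 - q b e ^ 2 - (q a' e - q a a' * q a e) ^ 2 / (1 - q a a' ^ 2) := by
  have hs : ∀ x y, q x y = q y x := fun x y => hq.eq x y
  set β := q a a' with hβdef
  have hk : 1 - β ^ 2 ≠ 0 := fun h => hβ (by linarith)
  have hba := (hs b a).trans hp.ab
  have hba' := (hs b a').trans hp'.ab
  have ha'a : q a' a = β := hs a' a
  refine ⟨e - q a e • a - q b e • b - ((q a' e - β * q a e) / (1 - β ^ 2)) • (a' - β • a),
    ?_, ?_, ?_, ?_⟩
  · simp [hp.aa, hp.ab, ← hβdef]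
  · simp [hp'.aa, hp'.ab, ha'a]
    field_simp
    ring
  · simp [hp.bb, hba, hba']
  · simp [hp.aa, hp.bb, hp.ab, hba, hba', hp'.aa, hp'.ab, ha'a, hs e a, hs e a', hs e b, ← hβdef]
    field_simp
    ring

theorem exists_smul_self_eq {m : H} {r : ℝ} (h : 0 < r / q m m) :
    ∃ t : ℝ, q (t • m) (t • m) = r := by
  have hm : q m m ≠ 0 := fun h0 => by simp [h0] at h
  refine ⟨Real.sqrt (r / q m m), ?_⟩
  simp only [map_smul, LinearMap.smul_apply, smul_eq_mul]
  rw [← mul_assoc, Real.mul_self_sqrt h.le]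
  field_simp

/-- For orthonormal pairs `a, b` and `a', b` in a space of signature `(3, p)`, `p ≥ 1`, a vector
`m` orthogonal to them such that `(a + a') / (q a a' + 1) + m` lies on isotropic lines through `a`
and `a'` in the unit quadric. -/
theorem exists_orthogonal_triple (hq : q.IsSymm)
    (hu : ∀ v w, ∃ u, q u u = 1 ∧ q v u = 0 ∧ q w u = 0) (he : ∃ e, q e e < 0)
    {a a' b : H} (hp : OrthoPair q a b) (hp' : OrthoPair q a' b) (hβ : 0 ≤ q a a') :
    ∃ m, q a m = 0 ∧ q a' m = 0 ∧ q b m = 0 ∧ q m m = (q a a' - 1) / (q a a' + 1) := by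
  suffices h : q a a' = 1 ∨ ∃ m, q a m = 0 ∧ q a' m = 0 ∧ q b m = 0 ∧
      0 < (q a a' - 1) / (q a a' + 1) / q m m by
    obtain h | ⟨m, h1, h2, h3, h4⟩ := h
    · exact ⟨0, by simp [h]⟩
    · obtain ⟨t, ht⟩ := exists_smul_self_eq h4
      exact ⟨t • m, by simp [h1], by simp [h2], by simp [h3], ht⟩
  -- If `q a a' < 1`, the span of `a, a', b` is positive definite, and projecting a negative vector
  -- keeps it negative. If `q a a' > 1`, the span has signature `(2, 1)`, and a unit vector
  -- orthogonal to `a, b` projects to a positive one.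
  obtain h | h | h := lt_trichotomy (q a a') 1
  · right
    obtain ⟨e, he⟩ := he
    obtain ⟨m, h1, h2, h3, h4⟩ := exists_projection hq hp hp' (by nlinarith) e
    refine ⟨m, h1, h2, h3, div_pos_of_neg_of_neg (div_neg_of_neg_of_pos ?_ ?_) ?_⟩
    · linarith
    · linarith
    · have : 0 ≤ (q a' e - q a a' * q a e) ^ 2 / (1 - q a a' ^ 2) :=
        div_nonneg (sq_nonneg _) (by nlinarith)
      rw [h4]
      linarith [sq_nonneg (q a e), sq_nonneg (q b e)]
  · exact Or.inl h
  · right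
    obtain ⟨f, hf, haf, hbf⟩ := hu a b
    obtain ⟨m, h1, h2, h3, h4⟩ := exists_projection hq hp hp' (by nlinarith) f
    refine ⟨m, h1, h2, h3, div_pos (div_pos ?_ ?_) ?_⟩
    · linarith
    · linarith
    · have : (q a' f - q a a' * q a f) ^ 2 / (1 - q a a' ^ 2) ≤ 0 :=
        div_nonpos_of_nonneg_of_nonpos (sq_nonneg _) (by nlinarith)
      rw [h4, hf, haf, hbf]
      rw [haf] at this
      linarith

theorem DiskContracting.le_of_common (hq : q.IsSymm) (hn : q.Nondegenerate)
    (hu : ∀ v w, ∃ u, q u u = 1 ∧ q v u = 0 ∧ q w u = 0) (he : ∃ e, q e e < 0)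
    {g : periodDomain q → ℝ≥0∞} (hg : DiskContracting q g) {a a' b : H} (hp : OrthoPair q a b)
    (hp' : OrthoPair q a' b) (hβ : 0 ≤ q a a') : g (hp.point hq) ≤ g (hp'.point hq) := by
  have hs : ∀ x y, q x y = q y x := fun x y => hq.eq x y
  obtain ⟨m, h1, h2, h3, h4⟩ := exists_orthogonal_triple hq hu he hp hp' hβ
  have hb0 : q a a' + 1 ≠ 0 := by linarith
  set c := (q a a' + 1)⁻¹ • (a + a') + m with hc
  have hpc : OrthoPair q c b := by
    -- The square of `(a + a') / (q a a' + 1)` is `2 / (q a a' + 1)`; the prescribed `q m m`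
    -- completes it to `1`.
    refine ⟨?_, hp.bb, ?_⟩
    · simp [hc, hp.aa, hp'.aa, hs a' a, hs m a, hs m a', h1, h2, h4]
      field_simp
      ring
    · simp [hc, hp.ab, hp'.ab, hs m b, h3]
  have hac : q a c = 1 := by
    simp [hc, hp.aa, h1]
    field_simp
    ring
  have hca' : q c a' = 1 := by
    simp [hc, hp'.aa, hs m a', h2]
    field_simp
  exact (hg.le_of_null hq hn hp hpc hac).trans (hg.le_of_null hq hn hpc hp' hca')

theorem OrthoPair.quarter_turn (hq : q.IsSymm) {a b : H} (h : OrthoPair q a b) :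
    OrthoPair q (-b) a :=
  ⟨by simp [h.bb], h.aa, by simp [(hq.eq b a).trans h.ab]⟩

theorem OrthoPair.point_quarter_turn (hq : q.IsSymm) {a b : H} (h : OrthoPair q a b) :
    (h.quarter_turn hq).point hq = h.point hq := by
  simpa using h.point_rotate hq 0 1 (by norm_num)

theorem OrthoPair.neg {a b : H} (h : OrthoPair q a b) : OrthoPair q (-a) (-b) :=
  ⟨by simp [h.aa], by simp [h.bb], by simp [h.ab]⟩

theorem OrthoPair.point_neg (hq : q.IsSymm) {a b : H} (h : OrthoPair q a b) :
    h.neg.point hq = h.point hq := by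
  simpa using h.point_rotate hq (-1) 0 (by norm_num)

theorem exists_mul_add_mul_eq_zero (x y : ℝ) :
    ∃ s t : ℝ, s ^ 2 + t ^ 2 = 1 ∧ t * x + s * y = 0 := by
  by_cases h : x = 0
  · exact ⟨0, 1, by norm_num, by simp [h]⟩
  · have hpos : 0 < x ^ 2 + y ^ 2 := by positivity
    refine ⟨x / Real.sqrt (x ^ 2 + y ^ 2), -y / Real.sqrt (x ^ 2 + y ^ 2), ?_, by ring⟩
    rw [div_pow, div_pow, Real.sq_sqrt hpos.le]
    field_simp

/-- A function that is contracting along positive disks of rational curves is constant. -/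
theorem DiskContracting.le (hq : q.IsSymm) (hn : q.Nondegenerate)
    (hu : ∀ v w, ∃ u, q u u = 1 ∧ q v u = 0 ∧ q w u = 0) (he : ∃ e, q e e < 0)
    {g : periodDomain q → ℝ≥0∞} (hg : DiskContracting q g) (x y : periodDomain q) :
    g x ≤ g y := by
  have hs : ∀ x y, q x y = q y x := fun x y => hq.eq x y
  obtain ⟨a, b, hx, rfl⟩ := exists_eq_orthoPair_point hq x
  obtain ⟨w', w, hy, rfl⟩ := exists_eq_orthoPair_point hq y
  -- The route is `(v', v) → (u, v) ~ (-v, u) → (z, u) ~ (-u, z) → (z', z)`, where `~` is a quarter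
  -- turn, which fixes the point of `D`. Rotations and sign changes arrange that in each move the
  -- exchanged vectors have non-negative product.
  obtain ⟨v', v, hv, hvw, hvx⟩ : ∃ (v' v : H) (hv : OrthoPair q v' v), q v w = 0 ∧
      hv.point hq = hx.point hq := by
    obtain ⟨s, t, hst, h0⟩ := exists_mul_add_mul_eq_zero (q a w) (q b w)
    exact ⟨_, _, hx.rotate hq s t hst, by simpa using h0, hx.point_rotate hq s t hst⟩
  obtain ⟨u, huu, hvu, hwu, hv'u⟩ : ∃ u, q u u = 1 ∧ q v u = 0 ∧ q w u = 0 ∧ 0 ≤ q v' u := by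
    obtain ⟨u, huu, hvu, hwu⟩ := hu v w
    obtain h | h := le_total 0 (q v' u)
    · exact ⟨u, huu, hvu, hwu, h⟩
    · exact ⟨-u, by simpa using huu, by simpa using hvu, by simpa using hwu, by simpa using h⟩
  obtain ⟨z', z, hz, hvz, hzu, huz', hzy⟩ : ∃ (z' z : H) (hz : OrthoPair q z' z), q v z = 0 ∧
      q z u = 0 ∧ q u z' ≤ 0 ∧ hz.point hq = hy.point hq := by
    obtain h | h := le_total (q u w') 0
    · exact ⟨w', w, hy, hvw, hwu, h, rfl⟩
    · exact ⟨-w', -w, hy.neg, by simpa using hvw, by simpa using hwu, by simpa using h,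
        hy.point_neg hq⟩
  have huv : OrthoPair q u v := ⟨huu, hv.bb, (hs u v).trans hvu⟩
  have hzu' : OrthoPair q z u := ⟨hz.bb, huu, hzu⟩
  have k1 := hg.le_of_common hq hn hu he hv huv hv'u
  have k2 := hg.le_of_common hq hn hu he (huv.quarter_turn hq) hzu' (by simp [hvz])
  have k3 := hg.le_of_common hq hn hu he (hzu'.quarter_turn hq) hz (by simpa using huz')
  rw [huv.point_quarter_turn hq] at k2
  rw [hzu'.point_quarter_turn hq] at k3
  rw [hvx] at k1
  rw [hzy] at k3
  exact k1.trans (k2.trans k3)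

/-! ### Chains of disks -/

/-- Adding a disk at the beginning of a chain. -/
def DiskChain.cons {X : Type*} {𝓕 : Set (ℂ → X)} {y : X} {f : ℂ → X} (hf : f ∈ 𝓕) {a b : ℂ}
    (ha : a ∈ disk) (hb : b ∈ disk) (c : DiskChain 𝓕 (f b) y) : DiskChain 𝓕 (f a) y where
  k := c.k + 1
  pt := Fin.cons (f a) c.pt
  pt_zero := rfl
  pt_last := by
    rw [← Fin.succ_last, Fin.cons_succ]
    exact c.pt_last
  a := Fin.cons a c.a
  b := Fin.cons b c.b
  a_mem := Fin.cases ha c.a_mem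
  b_mem := Fin.cases hb c.b_mem
  f := Fin.cons f c.f
  f_mem := Fin.cases hf c.f_mem
  f_a := Fin.cases rfl c.f_a
  f_b := Fin.cases c.pt_zero.symm c.f_b

theorem DiskChain.length_cons {X : Type*} {𝓕 : Set (ℂ → X)} {y : X} {f : ℂ → X} (hf : f ∈ 𝓕)
    {a b : ℂ} (ha : a ∈ disk) (hb : b ∈ disk) (c : DiskChain 𝓕 (f b) y) :
    (DiskChain.cons hf ha hb c).length = poincareDist a b + c.length :=
  Fin.sum_univ_succ _

/-- The chain without disks. -/
def DiskChain.nil {X : Type*} (𝓕 : Set (ℂ → X)) (x : X) : DiskChain 𝓕 x x where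
  k := 0
  pt := fun _ => x
  pt_zero := rfl
  pt_last := rfl
  a := Fin.elim0
  b := Fin.elim0
  a_mem := fun i => i.elim0
  b_mem := fun i => i.elim0
  f := Fin.elim0
  f_mem := fun i => i.elim0
  f_a := fun i => i.elim0
  f_b := fun i => i.elim0

theorem DiskChain.length_nil {X : Type*} (𝓕 : Set (ℂ → X)) (x : X) :
    (DiskChain.nil 𝓕 x).length = 0 :=
  Fin.sum_univ_zero _

theorem diskContracting_iInf_length (y : periodDomain q) :
    DiskContracting q (fun x => ⨅ c : DiskChain
      {f | IsPositiveDisk q f ∧ ExtendsToRationalCurve q f} x y, c.length) := by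
  intro f hf hf' a ha b hb
  rw [ENNReal.add_iInf]
  refine le_iInf fun c => ?_
  rw [← DiskChain.length_cons (show f ∈ {f | _ ∧ _} from ⟨hf, hf'⟩) ha hb c]
  exact iInf_le _ _

theorem diskContracting_positiveKobayashi (y : periodDomain q) :
    DiskContracting q (fun x => positiveKobayashi q x y) := by
  intro f hf _ a ha b hb
  obtain ⟨⟨_, _, htri⟩, hle⟩ := (isGreatest_positiveKobayashi q).1
  exact (htri _ _ _).trans (add_le_add_left (hle f hf a ha b hb) _)

end K3Period

end

theorem proposition5p9 {H : Type*} [AddCommGroup H] [Module ℝ H] [FiniteDimensional ℝ H]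
    (q : LinearMap.BilinForm ℝ H) (p : ℕ) (hsymm : q.IsSymm) (hnondeg : q.Nondegenerate)
    (hpos : sigPos q.toQuadraticMap = 3) (hneg : sigNeg q.toQuadraticMap = p)
    (hdim : 2 ≤ K3Period.dim q) :
    (∀ x y : K3Period.periodDomain q, K3Period.positiveKobayashi q x y = 0) ∧
    (∀ x y : K3Period.periodDomain q, K3Period.positiveKobayashi q x y =
      ⨅ c : K3Period.DiskChain
        {f | K3Period.IsPositiveDisk q f ∧ K3Period.ExtendsToRationalCurve q f} x y, c.length) := by
  have hu := K3Period.exists_unit_orthogonal hpos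
  have he := K3Period.exists_neg hsymm hnondeg hpos hdim
  have h1 : ∀ x y : K3Period.periodDomain q, K3Period.positiveKobayashi q x y = 0 := by
    intro x y
    refine le_antisymm ?_ bot_le
    -- Contracting functions compare any two points, so the value at `x` is bounded by the value at
    -- `y`, which is `0`.
    rw [← (K3Period.isGreatest_positiveKobayashi q).1.1.self y]
    exact (K3Period.diskContracting_positiveKobayashi y).le hsymm hnondeg hu he x y
  refine ⟨h1, fun x y => ?_⟩
  rw [h1]
  refine le_antisymm bot_le ?_
  refine ((K3Period.diskContracting_iInf_length y).le hsymm hnondeg hu he x y).trans ?_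
  -- At `y` itself the chain without disks has length `0`.
  refine (iInf_le _ (K3Period.DiskChain.nil _ y)).trans ?_
  rw [K3Period.DiskChain.length_nil]
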